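/- **Setting.** Let $O\subset\mathbb R^2$ be a closed set of obstacle points, $R>0$ the radius of a disc-shaped robot and $\varepsilon>0$ a tolerance. Put $M_{\rm free}=\{x:\ |x-y|\ge R\ \text{for all } y\in O\}$. Paths are continuous paths in $M_{\rm free}$, homotopies are taken in $M_{\rm free}$ with fixed endpoints, and $g$ denotes length. Let $p_{start},p_{goal}\in M_{\rm free}$ be joined by a path of finite length; call a point reachable if it is joined to $p_{start}$ by a path of finite length. **Distinguished homotopies.** For a path $\gamma$ from $p_{start}$ to $p$ and a point $q\in M_{\rm free}$, let $\varphi_q^{-1}([\gamma])$ be the set of paths from $p_{start}$ to $q$ that visit $p$ at some time such that the part up to that time is homotopic to $\gamma$, and let $\min_{[\gamma]}g(q)$ be the infimum of the lengths of these paths. We write $[\gamma_1]\prec[\gamma_2]$ *for the goal* $q$ if $\min_{[\gamma_1]}g(q)<\min_{[\gamma_2]}g(q)$, and simply $[\gamma_1]\prec[\gamma_2]$ for $q=p_{goal}$. A set $\Omega\subset M_{\rm free}$ *satisfies the relaxation conditions* for $[\gamma_1],[\gamma_2]$ if $p_{start}\notin\Omega$, $p_{goal}\in\Omega$, and $[\gamma_1]\prec[\gamma_2]$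 for every goal $q$ that is a reachable collision-free point of the boundary of $\Omega$. It *is an $\Omega$ region* if moreover it is connected. **Topological tree.** A node with source point $p$ has finitely many rays from $p$ with increasing orientations $\theta$, each ending at the first obstacle point $e(\theta)$ it hits. The endpoints of two consecutive rays are at distance less than $2R$, unless there is a gap between the two rays. The $k$-th gap of node $i$ (source point $p=p^i$) comes from a short ray, of length $\Phi_{\rm near}$ and endpoint $e_{\rm n}$, which is one of these two consecutive rays, and a longer ray, of length $\Phi_{\rm far}$, whose endpoints are at distance at least $2R$ and such that $e_{\rm n}$ has distance less than $\varepsilon$ from the line of the long ray. Let $\vec a$ be the unit vector along the long ray and $\vec b$ the unit normal to it pointing away from the short ray, that is, $\vec a$ turned by $+\pi/2$ if the short ray has the smaller orientation and by $-\pi/2$ otherwise. The corridor is the collision-free part of $\{p+\phi\vec a+\psi\vec b:\ 0\le\phi\le\Phi_{\rm near},\ |\psi|\le R\}$, the critical point is $c_k^i=p+\Phi_{\rm near}\vec a+R\vec b$, assumed collision-free, and the edge $\alpha_k^i$ is a shortest path (of finite length) from $p$ to $c_k^i$ in the corridor. The gap sweeper $\Delta_k^i$ is the longest collision-free segment $\{p+\phi\vec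 a+R\vec b:\ \Phi_{\rm near}\le\phi\le\phi_o\}$ with $\phi_o\le\Phi_{\rm far}$; let $o_k^i$ be its endpoint and $e_{\rm f}\in O$ an obstacle point with $|e_{\rm f}-o_k^i|=R$ and $(e_{\rm f}-o_k^i)\cdot\vec a\ge0$. The other one of the two consecutive rays points at $e_{\rm f}$ or ends at distance less than $2R$ from it. The rays of the root, whose source point is $p_{start}$, make a full turn, consecutive ones enclosing an angle less than $\pi$. A child of node $i$ arises by expanding a critical point $c_k^i$: its source point is $c_k^i$ and its rays range over the orientations between those of $e_{\rm n}$ and $e_{\rm f}$ seen from $c_k^i$. Each critical point is expanded at most once. The contour of a node joins the endpoints of consecutive rays, through the points $e_{\rm n},c_k,o_k,e_{\rm f}$ at each gap; for a child it is closed by the polyline $e_{\rm n},c_k^i,o_k^i,e_{\rm f}$ of the gap of the parent that was expanded. The sub-region $Q^i$ consists of the collision-free points that lie on the contour, or are separated from infinity by it, and of the source point. The tree path of $c_k^i$ is the concatenation of the edges leading from $p_{start}$ to $c_k^i$, and $[c_k^i]$ is its distinguished homotopy. Let $P_i$ be the set of predecessors of node $i$, and $$U_{[c_k^i]}=M_{\rm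 free}\setminus\bigcup_{m\in P_i\cup\{i\}}Q^m .$$ **Theorem (Construction of the $\Omega$ region).** Let $c_k^i$ and $c_l^j$ be critical points of nodes $i,j$ of a topological tree, and suppose that $p_{goal}\notin Q^m$ for all $m\in P_i\cup\{i\}$. If $$\min_{[c_l^j]}g(m)<\min_{[c_k^i]}g(m)\qquad\text{for all } m\in\Delta_k^i,$$ then $U_{[c_k^i]}$ satisfies the relaxation conditions for $[c_l^j],[c_k^i]$; the connected component of $U_{[c_k^i]}$ that contains $p_{goal}$ is an $\Omega$ region for them, and so is $U_{[c_k^i]}$ itself if it is connected; and $[c_l^j]\prec[c_k^i]$. -/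

import Mathlib

open scoped ENNReal unitInterval

noncomputable section

namespace SNPP

/-- A planar environment: a closed set of obstacle points in the plane (identified with `ℂ`),
the radius `R` of the circular robot, and the tolerance `ε` of the raycasting. -/
structure World where
  obst : Set ℂ
  isClosed_obst : IsClosed obst
  R : ℝ
  R_pos : 0 < R
  ε : ℝ
  ε_pos : 0 < ε

namespace World

/-- The collision-free part of the environment: positions of the centre of the robot at which no
obstacle point lies in the interior of its footprint (touching an obstacle is allowed). -/
def free (W : World) : Set ℂ := {x | ∀ y ∈ W.obst, W.R ≤ dist x y}

/-- Collision-free locations, as a topological space. Its `Path`s are the collision-free paths, and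
`Path.Homotopic` is homotopy with fixed endpoints inside the collision-free part. -/
abbrev Conf (W : World) : Type := {x : ℂ // x ∈ W.free}

end World

variable {W : World}

/-- The length `g` of a path (possibly infinite). -/
def pathLength {x y : W.Conf} (γ : Path x y) : ℝ≥0∞ :=
  eVariationOn (fun t : I => ((γ t : W.Conf) : ℂ)) Set.univ

/-- `q` is joined to `s` by a collision-free path of finite length. -/
def Reachable (s q : W.Conf) : Prop := ∃ γ : Path s q, pathLength γ ≠ ∞

/-! ### Distinguished homotopies -/

/-- For a path `γ` from `s` to `p`, the paths from `s` to the (possibly fake) goal `q` that belong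
to the distinguished homotopy `[γ]`: those that visit `p` at some time `t`, the part up to the
time `t` being homotopic to `γ`. -/
def distinguished {s p : W.Conf} (γ : Path s p) (q : W.Conf) : Set (Path s q) :=
  {η | ∃ (t : I) (ht : η t = p), Path.Homotopic ((η.subpath 0 t).cast η.source.symm ht.symm) γ}

/-- The minimal length of the paths in `[γ]` that end at `q`, as an infimum. -/
def minLength {s p : W.Conf} (γ : Path s p) (q : W.Conf) : ℝ≥0∞ :=
  ⨅ η ∈ distinguished γ q, pathLength η

/-- Relative optimality `[γ₁] ≺ [γ₂]` of distinguished homotopies, for the goal `q`. -/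
def Prec {s p₁ p₂ : W.Conf} (q : W.Conf) (γ₁ : Path s p₁) (γ₂ : Path s p₂) : Prop :=
  minLength γ₁ q < minLength γ₂ q

/-- The requirements of goal location relaxation on a region `Ω`, apart from connectedness:
`Ω` is collision-free, contains the goal but not the start, and `[γ₁] ≺ [γ₂]` holds for every
collision-free point of the boundary of `Ω` taken as a fake goal (a fake goal has to be reachable,
otherwise there is no path to it at all). -/
structure IsRelaxation {s p₁ p₂ : W.Conf} (goal : W.Conf) (γ₁ : Path s p₁) (γ₂ : Path s p₂)
    (Ω : Set ℂ) : Prop where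
  subset_free : Ω ⊆ W.free
  start_notMem : (s : ℂ) ∉ Ω
  goal_mem : (goal : ℂ) ∈ Ω
  boundary : ∀ q : W.Conf, (q : ℂ) ∈ frontier Ω → Reachable s q → Prec q γ₁ γ₂

/-- `Ω` is a region as in goal location relaxation, connectedness included. -/
structure IsOmega {s p₁ p₂ : W.Conf} (goal : W.Conf) (γ₁ : Path s p₁) (γ₂ : Path s p₂)
    (Ω : Set ℂ) : Prop extends IsRelaxation goal γ₁ γ₂ Ω where
  connected : IsConnected Ω

/-! ### Rays, gaps, corridors and gap sweepers -/

/-- The unit vector with orientation `θ`. -/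
def dir (θ : ℝ) : ℂ := Complex.exp (θ * Complex.I)

/-- `θ` is an orientation of the point `x` as seen from `p`. -/
def IsOrientation (p x : ℂ) (θ : ℝ) : Prop := x - p = (‖x - p‖ : ℝ) • dir θ

/-- A ray from `p`, extended until it hits an obstacle: `len` is its length. -/
structure Ray (W : World) (p : W.Conf) where
  θ : ℝ
  len : ℝ
  isLeast_len : IsLeast {t : ℝ | 0 ≤ t ∧ (p : ℂ) + t • dir θ ∈ W.obst} len

/-- The obstacle point `e(θ)` hit by the ray. -/
def Ray.endpt {p : W.Conf} (r : Ray W p) : ℂ := (p : ℂ) + r.len • dir r.θ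

/-- Which ray of a gap comes first in the order of increasing orientation: the short one
(`nearFirst`) or the long one (`farFirst`). The two cases are mirror images. -/
inductive Side
  | nearFirst
  | farFirst

/-- The sign of the offset of the critical point from the long ray, away from the short ray. -/
def Side.sign : Side → ℝ
  | .nearFirst => 1
  | .farFirst => -1

/-- The point with coordinates `(x, y)` in the orthonormal frame `(a, b)` at `p`, where `a` is the
unit vector of orientation `θ` and `b` is `a` turned by a right angle. -/
def framePt (p : ℂ) (θ x y : ℝ) : ℂ := p + x • dir θ + y • dir (θ + Real.pi / 2)

/-- The corridor of a gap: the collision-free part of the rectangle of width `2R` that lies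
symmetrically on the long ray and is as long as the short ray. -/
def corridor {p : W.Conf} (near far : Ray W p) : Set W.Conf :=
  {z | ∃ x ∈ Set.Icc 0 near.len, ∃ y ∈ Set.Icc (-W.R) W.R, (z : ℂ) = framePt p far.θ x y}

/-- A gap of the node with source point `p`, whose short and long rays are `near` and `far`,
together with what planning in the corridor and sweeping the gap construct from it. -/
structure Gap (W : World) (p : W.Conf) where
  near : Ray W p
  far : Ray W p
  side : Side
  /-- the short ray is the first or the second one -/
  order : match side with
    | .nearFirst => near.θ < far.θ
    | .farFirst => far.θ < near.θ
  near_lt_far : near.len < far.len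
  /-- the robot may fit between the endpoints of the two rays -/
  not_close : 2 * W.R ≤ dist near.endpt far.endpt
  /-- the endpoint of the short ray is near the long ray -/
  near_eps : near.len ^ 2 - (inner ℝ (near.endpt - p) (far.endpt - p) / far.len) ^ 2 < W.ε ^ 2
  /-- the critical point, a corner of the corridor -/
  crit : W.Conf
  crit_eq : (crit : ℂ) = framePt p far.θ near.len (side.sign * W.R)
  /-- the edge: a shortest path from the source point to the critical point in the corridor -/
  edge : Path p crit
  edge_mem : ∀ t, edge t ∈ corridor near far
  edge_finite : pathLength edge ≠ ∞
  edge_min : ∀ β : Path p crit, (∀ t, β t ∈ corridor near far) → pathLength edge ≤ pathLength β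
  /-- how far along the long ray the sweeping from the critical point gets without collision -/
  reach : ℝ
  isGreatest_reach : IsGreatest {x : ℝ | x ∈ Set.Icc near.len far.len ∧
    ∀ x' ∈ Set.Icc near.len x, framePt p far.θ x' (side.sign * W.R) ∈ W.free} reach
  /-- the obstacle point that stops the sweeping: it touches the robot, not from behind -/
  stopper : ℂ
  stopper_mem : stopper ∈ W.obst
  dist_stopper : dist (framePt p far.θ reach (side.sign * W.R)) stopper = W.R
  stopper_ahead :
    0 ≤ inner ℝ (stopper - framePt p far.θ reach (side.sign * W.R)) (dir far.θ)

namespace Gap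

variable {p : W.Conf}

/-- The endpoint of the gap sweeper. -/
def sweepEnd (g : Gap W p) : ℂ := framePt p g.far.θ g.reach (g.side.sign * W.R)

/-- The gap sweeper: the segment checked from the critical point on, in the direction of the
long ray. -/
def sweeper (g : Gap W p) : Set W.Conf :=
  {z | ∃ x ∈ Set.Icc g.near.len g.reach, (z : ℂ) = framePt p g.far.θ x (g.side.sign * W.R)}

/-- The piece of contour through the endpoint of the short ray, the critical point, the endpoint
of the gap sweeper and the obstacle point that stopped the sweeping. -/
def contour (g : Gap W p) : Set ℂ :=
  segment ℝ g.near.endpt g.crit ∪ segment ℝ (g.crit : ℂ) g.sweepEnd ∪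
    segment ℝ g.sweepEnd g.stopper

/-- Among consecutive rays `r`, `r'`, the one that is the short ray of a gap between them. -/
def nearOf (g : Gap W p) (r r' : Ray W p) : Ray W p :=
  match g.side with
  | .nearFirst => r
  | .farFirst => r'

/-- Among consecutive rays `r`, `r'`, the one on the far side of a gap between them. -/
def farOf (g : Gap W p) (r r' : Ray W p) : Ray W p :=
  match g.side with
  | .nearFirst => r'
  | .farFirst => r

end Gap

/-! ### Nodes and their sub-regions -/

/-- An expanded node with source point `p`: its final list of rays in the order of increasing
orientation, and its gaps, the `k`-th one between the rays number `pos k` and `pos k + 1`. -/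
structure Node (W : World) (p : W.Conf) where
  n : ℕ
  ray : Fin (n + 1) → Ray W p
  strictMono_ray : StrictMono fun j => (ray j).θ
  numGaps : ℕ
  gap : Fin numGaps → Gap W p
  pos : Fin numGaps → Fin n
  strictMono_pos : StrictMono pos
  /-- where there is no gap, the robot cannot pass between the endpoints of consecutive rays -/
  close : ∀ j : Fin n, j ∉ Set.range pos →
    dist (ray j.castSucc).endpt (ray j.succ).endpt < 2 * W.R
  near_eq : ∀ k, (gap k).near = (gap k).nearOf (ray (pos k).castSucc) (ray (pos k).succ)
  far_mem : ∀ k, (gap k).far.θ ∈ Set.Icc (ray 0).θ (ray (Fin.last n)).θ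
  /-- a ray points at the obstacle that stopped the sweeping and the rays between it and the short
  ray are removed; further rays are removed only where the robot cannot pass -/
  stopper_ray : ∀ k,
    IsOrientation p (gap k).stopper
        ((gap k).farOf (ray (pos k).castSucc) (ray (pos k).succ)).θ ∨
      dist (gap k).stopper
        ((gap k).farOf (ray (pos k).castSucc) (ray (pos k).succ)).endpt < 2 * W.R

namespace Node

variable {p : W.Conf}

/-- The first orientation of the rays. -/
def θmin (N : Node W p) : ℝ := (N.ray 0).θ

/-- The last orientation of the rays. -/
def θmax (N : Node W p) : ℝ := (N.ray (Fin.last N.n)).θ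

/-- The contour formed by the endpoints of consecutive rays and the contours of the gaps. -/
def contour (N : Node W p) : Set ℂ :=
  (⋃ j ∈ (Set.range N.pos)ᶜ, segment ℝ (N.ray j.castSucc).endpt (N.ray j.succ).endpt) ∪
    ⋃ k, ((N.gap k).contour ∪ segment ℝ (N.gap k).stopper
      ((N.gap k).farOf (N.ray (N.pos k).castSucc) (N.ray (N.pos k).succ)).endpt)

/-- The rays of the root node make a full turn, consecutive ones enclosing less than a
straight angle. -/
structure IsRoot (N : Node W p) : Prop where
  full_turn : N.θmax = N.θmin + 2 * Real.pi
  step_lt : ∀ j : Fin N.n, (N.ray j.succ).θ - (N.ray j.castSucc).θ < Real.pi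

/-- The node `N`, whose source point is the critical point of the gap `g` of its parent, has rays
in the range of orientations that `g` prescribes: between the endpoint of the short ray and the
obstacle point that stopped the sweeping. -/
structure IsChild {p' : W.Conf} (g : Gap W p') (N : Node W g.crit) : Prop where
  range : match g.side with
    | .nearFirst => IsOrientation g.crit g.near.endpt N.θmin ∧
        IsOrientation g.crit g.stopper N.θmax
    | .farFirst => IsOrientation g.crit g.stopper N.θmin ∧
        IsOrientation g.crit g.near.endpt N.θmax
  min_nonneg : 0 ≤ N.θmin
  min_lt : N.θmin < 2 * Real.pi
  min_lt_max : N.θmin < N.θmax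
  max_lt : N.θmax < N.θmin + 2 * Real.pi

end Node

/-- The collision-free part of the region bounded by the contour `C` around the source point `p`:
the point `p`, the points of `C`, and those that `C` separates from infinity. -/
def enclosed (p : W.Conf) (C : Set ℂ) : Set ℂ :=
  {x | x ∈ W.free ∧ (x = p ∨ x ∈ C ∨ Bornology.IsBounded (connectedComponentIn Cᶜ x))}

/-! ### The topological tree -/

/-- A node of the hierarchical topological tree with start point `s`, given with the chain of its
predecessors: either the root, whose source point is `s`, or a child of a node `b`, obtained by
expanding the `k`-th critical point of `b`. -/
inductive Branch (s : W.Conf) : (p : W.Conf) → Node W p → Type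
  | root (N : Node W s) (h : N.IsRoot) : Branch s s N
  | child {p : W.Conf} {N : Node W p} (b : Branch s p N) (k : Fin N.numGaps)
      (N' : Node W (N.gap k).crit) (h : Node.IsChild (N.gap k) N') : Branch s (N.gap k).crit N'

namespace Branch

variable {s : W.Conf}

/-- The tree path of the source point of a node: the concatenation of edges. -/
def treePath {p : W.Conf} {N : Node W p} : Branch s p N → Path s p
  | root _ _ => Path.refl s
  | @child _ _ _ M b k _ _ => b.treePath.trans (M.gap k).edge

/-- The tree path of the `k`-th critical point of a node. -/
def critPath {p : W.Conf} {N : Node W p} (b : Branch s p N) (k : Fin N.numGaps) :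
    Path s (N.gap k).crit :=
  b.treePath.trans (N.gap k).edge

/-- The sub-region `Q` of a node. The contour of a node other than the root is closed by that of
the gap through which it is entered. -/
def subRegion {p : W.Conf} {N : Node W p} : Branch s p N → Set ℂ
  | root N _ => enclosed s N.contour
  | @child _ _ _ M _ k N' _ => enclosed (M.gap k).crit ((M.gap k).contour ∪ N'.contour)

/-- The union of the sub-regions of a node and of all its predecessors. -/
def covered {p : W.Conf} {N : Node W p} : Branch s p N → Set ℂ
  | root N h => (root N h).subRegion
  | child b k N' h => (child b k N' h).subRegion ∪ b.covered

/-- The uncovered region of the distinguished homotopies `[c_k]` of the critical points of a node: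
the collision-free area minus the sub-regions of the node and its predecessors. -/
def uncovered {p : W.Conf} {N : Node W p} (b : Branch s p N) : Set ℂ := W.free \ b.covered

end Branch

/-- A hierarchical topological tree at some stage of the planning: it has one root, contains the
parents of its nodes, and each critical point has been expanded at most once. -/
structure TopologicalTree (s : W.Conf) where
  mem : ∀ {p : W.Conf} {N : Node W p}, Branch s p N → Prop
  rootNode : Node W s
  isRoot : rootNode.IsRoot
  mem_root : ∀ N h, mem (Branch.root N h) ↔ N = rootNode
  mem_parent : ∀ {p : W.Conf} {N : Node W p} (b : Branch s p N) k N' h,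
    mem (Branch.child b k N' h) → mem b
  expand_unique : ∀ {p : W.Conf} {N : Node W p} (b : Branch s p N) k N₁ h₁ N₂ h₂,
    mem (Branch.child b k N₁ h₁) → mem (Branch.child b k N₂ h₂) → N₁ = N₂

end SNPP

end

/-!
A path in `[γ]` from `s` to `q` visits the endpoint `p` of `γ`; cutting it there shows that
`min_[γ] g(q) = min_[γ] g(p) + d(p, q)`, where `d` is the infimum of the lengths of collision-free
paths. Extending a path in `[γ]` keeps it in `[γ]`, so `min_[γ] g(q) ≤ min_[γ] g(c) + d(c, q)` for
*every* point `c`. Applying the equality to `[c_k^i]` and the inequality to `[c_l^j]`, both at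
`c_k^i`, carries the comparison from the critical point, which lies on the gap sweeper, over to all
reachable goals, and in particular to those on the boundary of the uncovered region.
-/

namespace SNPP

open Set

noncomputable section

theorem monotone_convexComb {a b : ℝ} {t₀ t₁ : Icc a b} (h : t₀ ≤ t₁) :
    Monotone (Icc.convexComb t₀ t₁) := by
  intro r s hrs
  have hrs' : (r : ℝ) ≤ s := hrs
  have h' : (t₀ : ℝ) ≤ t₁ := h
  rw [← Subtype.coe_le_coe, Icc.coe_convexComb, Icc.coe_convexComb]
  nlinarith only [hrs', h']

section VariationAlongPaths

variable {X E : Type*} [TopologicalSpace X] [PseudoEMetricSpace E] {x y z : X}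

/-- The time at which the concatenation of two paths switches from the first to the second. -/
def half : I := ⟨1 / 2, by norm_num, by norm_num⟩

theorem trans_convexComb_zero_half (γ : Path x y) (γ' : Path y z) (t : I) :
    (γ.trans γ') (Icc.convexComb 0 half t) = γ t := by
  have htime : (Icc.convexComb 0 half t : ℝ) = t / 2 := by
    simp only [Icc.coe_convexComb, Icc.coe_zero, half]
    ring
  calc (γ.trans γ') (Icc.convexComb 0 half t) = (γ.trans γ').extend (t / 2) := by
        rw [← htime, Path.extend_extends']
    _ = γ.extend (2 * (t / 2)) := Path.extend_trans_of_le_half _ _ (by linarith [t.2.2])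
    _ = γ t := by rw [mul_div_cancel₀ _ two_ne_zero, Path.extend_extends']

theorem trans_convexComb_half_one (γ : Path x y) (γ' : Path y z) (t : I) :
    (γ.trans γ') (Icc.convexComb half 1 t) = γ' t := by
  have htime : (Icc.convexComb half 1 t : ℝ) = (1 + t) / 2 := by
    simp only [Icc.coe_convexComb, Icc.coe_one, half]
    ring
  calc (γ.trans γ') (Icc.convexComb half 1 t) = (γ.trans γ').extend ((1 + t) / 2) := by
        rw [← htime, Path.extend_extends']
    _ = γ'.extend (2 * ((1 + t) / 2) - 1) :=
        Path.extend_trans_of_half_le _ _ (by linarith [t.2.1])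
    _ = γ' t := by rw [mul_div_cancel₀ _ two_ne_zero, add_sub_cancel_left, Path.extend_extends']

theorem eVariationOn_comp_symm (f : X → E) (γ : Path x y) :
    eVariationOn (f ∘ γ.symm) univ = eVariationOn (f ∘ γ) univ := by
  have hcomp := eVariationOn.comp_eq_of_antitoneOn (f ∘ γ) (t := univ) unitInterval.symm
    (unitInterval.strictAnti_symm.antitone.antitoneOn _)
  rwa [image_univ, unitInterval.symm_bijective.surjective.range_eq] at hcomp

theorem eVariationOn_comp_subpath (f : X → E) (γ : Path x y) {t₀ t₁ : I} (h : t₀ ≤ t₁) :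
    eVariationOn (f ∘ γ.subpath t₀ t₁) univ = eVariationOn (f ∘ γ) (Icc t₀ t₁) := by
  have hcomp := eVariationOn.comp_eq_of_monotoneOn (f ∘ γ) (t := univ) (Icc.convexComb t₀ t₁)
    ((monotone_convexComb h).monotoneOn _)
  rwa [image_univ, Path.range_subpathAux, uIcc_of_le h] at hcomp

theorem eVariationOn_comp_subpath_add (f : X → E) (γ : Path x y) (t : I) :
    eVariationOn (f ∘ γ.subpath 0 t) univ + eVariationOn (f ∘ γ.subpath t 1) univ =
      eVariationOn (f ∘ γ) univ := by
  have hadd := eVariationOn.Icc_add_Icc (f ∘ γ) (unitInterval.nonneg' (t := t))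
    unitInterval.le_one' (mem_univ t)
  have hI : Icc (0 : I) 1 = univ := Icc_bot_top
  rw [eVariationOn_comp_subpath f γ unitInterval.nonneg',
    eVariationOn_comp_subpath f γ unitInterval.le_one']
  simpa only [univ_inter, hI] using hadd

theorem eVariationOn_comp_trans (f : X → E) (γ : Path x y) (γ' : Path y z) :
    eVariationOn (f ∘ γ.trans γ') univ =
      eVariationOn (f ∘ γ) univ + eVariationOn (f ∘ γ') univ := by
  have hγ : ⇑((γ.trans γ').subpath 0 half) = γ := funext (trans_convexComb_zero_half γ γ')
  have hγ' : ⇑((γ.trans γ').subpath half 1) = γ' := funext (trans_convexComb_half_one γ γ')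
  rw [← eVariationOn_comp_subpath_add f (γ.trans γ') half, hγ, hγ']

end VariationAlongPaths

variable {W : World} {s p q : W.Conf}

theorem pathLength_symm (γ : Path p q) : pathLength γ.symm = pathLength γ :=
  eVariationOn_comp_symm Subtype.val γ

theorem pathLength_trans {r : W.Conf} (γ : Path p q) (γ' : Path q r) :
    pathLength (γ.trans γ') = pathLength γ + pathLength γ' :=
  eVariationOn_comp_trans Subtype.val γ γ'

theorem pathLength_subpath_add (γ : Path p q) (t : I) :
    pathLength (γ.subpath 0 t) + pathLength (γ.subpath t 1) = pathLength γ :=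
  eVariationOn_comp_subpath_add Subtype.val γ t

theorem Reachable.symm (h : Reachable p q) : Reachable q p :=
  let ⟨γ, hγ⟩ := h
  ⟨γ.symm, (pathLength_symm γ).trans_ne hγ⟩

theorem Reachable.trans {r : W.Conf} (hpq : Reachable p q) (hqr : Reachable q r) :
    Reachable p r :=
  let ⟨γ, hγ⟩ := hpq
  let ⟨γ', hγ'⟩ := hqr
  ⟨γ.trans γ', (pathLength_trans γ γ').trans_ne (ENNReal.add_ne_top.2 ⟨hγ, hγ'⟩)⟩

/-- The path-length distance `d(p, q)` in the collision-free area: the infimum of the lengths of the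
collision-free paths from `p` to `q`, equal to `∞` when there is none of finite length. -/
def freeDist (p q : W.Conf) : ℝ≥0∞ := ⨅ β : Path p q, pathLength β

theorem Reachable.freeDist_ne_top (h : Reachable p q) : freeDist p q ≠ ∞ :=
  let ⟨β, hβ⟩ := h
  ne_top_of_le_ne_top hβ (iInf_le _ β)

theorem trans_mem_distinguished {c : W.Conf} {γ : Path s p} {η : Path s c}
    (hη : η ∈ distinguished γ c) (β : Path c q) : η.trans β ∈ distinguished γ q := by
  obtain ⟨t, ht, hom⟩ := hη
  refine ⟨Icc.convexComb 0 half t, (trans_convexComb_zero_half η β t).trans ht, ?_⟩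
  convert hom using 1
  refine Path.ext (funext fun r => ?_)
  have hassoc : Icc.convexComb 0 (Icc.convexComb 0 half t) r =
      Icc.convexComb 0 half (Icc.convexComb 0 t r) :=
    Subtype.ext (by simp only [Icc.coe_convexComb, Icc.coe_zero]; ring)
  calc (η.trans β) (Icc.convexComb 0 (Icc.convexComb 0 half t) r)
      = (η.trans β) (Icc.convexComb 0 half (Icc.convexComb 0 t r)) := by rw [hassoc]
    _ = η (Icc.convexComb 0 t r) := trans_convexComb_zero_half η β _

theorem minLength_le_add_freeDist (γ : Path s p) (c q : W.Conf) :
    minLength γ q ≤ minLength γ c + freeDist c q := by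
  simp only [minLength, freeDist, ENNReal.iInf_add, ENNReal.add_iInf]
  refine le_iInf fun β => le_iInf₂ fun η hη => ?_
  calc ⨅ ζ ∈ distinguished γ q, pathLength ζ
      ≤ pathLength (η.trans β) := iInf₂_le _ (trans_mem_distinguished hη β)
    _ = pathLength η + pathLength β := pathLength_trans η β

theorem mem_distinguished_of_homotopic {γ η : Path s p} (h : η.Homotopic γ) :
    η ∈ distinguished γ p :=
  ⟨1, η.target, by rw [Path.subpath_zero_one]; exact h⟩

theorem minLength_eq_add_freeDist (γ : Path s p) (q : W.Conf) :
    minLength γ q = minLength γ p + freeDist p q := by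
  refine le_antisymm (minLength_le_add_freeDist γ p q) (le_iInf₂ fun η ⟨t, ht, hom⟩ => ?_)
  let toEnd : Path s p := (η.subpath 0 t).cast η.source.symm ht.symm
  let fromEnd : Path p q := (η.subpath t 1).cast ht.symm η.target.symm
  calc minLength γ p + freeDist p q
      ≤ pathLength toEnd + pathLength fromEnd :=
        add_le_add (iInf₂_le toEnd (mem_distinguished_of_homotopic hom)) (iInf_le _ fromEnd)
    _ = pathLength η := pathLength_subpath_add η t

theorem Reachable.of_minLength_ne_top {γ : Path s p} (h : minLength γ q ≠ ∞) : Reachable s q := by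
  obtain ⟨η, hη⟩ := iInf_lt_iff.1 h.lt_top
  obtain ⟨-, hfinite⟩ := iInf_lt_iff.1 hη
  exact ⟨η, hfinite.ne⟩

section Prec

variable {p₁ p₂ goal : W.Conf} {γ₁ : Path s p₁} {γ₂ : Path s p₂}

theorem Prec.of_endpoint (h : Prec p₂ γ₁ γ₂) (hq : Reachable s q) : Prec q γ₁ γ₂ := by
  have hp₂ : Reachable s p₂ := .of_minLength_ne_top (ne_top_of_lt h)
  have hdist : freeDist p₂ q ≠ ∞ := (hp₂.symm.trans hq).freeDist_ne_top
  calc minLength γ₁ q ≤ minLength γ₁ p₂ + freeDist p₂ q := minLength_le_add_freeDist γ₁ p₂ q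
    _ < minLength γ₂ p₂ + freeDist p₂ q := ENNReal.add_lt_add_right hdist h
    _ = minLength γ₂ q := (minLength_eq_add_freeDist γ₂ q).symm

theorem Prec.isRelaxation (h : Prec p₂ γ₁ γ₂) {Ω : Set ℂ} (hfree : Ω ⊆ W.free)
    (hs : (s : ℂ) ∉ Ω) (hgoal : (goal : ℂ) ∈ Ω) : IsRelaxation goal γ₁ γ₂ Ω where
  subset_free := hfree
  start_notMem := hs
  goal_mem := hgoal
  boundary _ _ hq := h.of_endpoint hq

end Prec

theorem Gap.crit_mem_sweeper (g : Gap W p) : g.crit ∈ g.sweeper :=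
  ⟨g.near.len, left_mem_Icc.2 g.isGreatest_reach.1.1.1, g.crit_eq⟩

theorem Branch.start_mem_covered {N : Node W p} (b : Branch s p N) : (s : ℂ) ∈ b.covered := by
  induction b with
  | root _ _ => exact ⟨s.2, Or.inl rfl⟩
  | child _ _ _ _ ih => exact Or.inr ih

end

end SNPP

theorem mainTheorem2_general {W : SNPP.World} {start goal p₁ p₂ : W.Conf}
    (hreach : SNPP.Reachable start goal) {γ₁ : Path start p₁} {γ₂ : Path start p₂}
    (hlt : SNPP.Prec p₂ γ₁ γ₂) {Ω : Set ℂ} (hfree : Ω ⊆ W.free) (hstart : (start : ℂ) ∉ Ω)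
    (hgoal : (goal : ℂ) ∈ Ω) :
    SNPP.IsRelaxation goal γ₁ γ₂ Ω ∧
      SNPP.IsOmega goal γ₁ γ₂ (connectedComponentIn Ω goal) ∧
      (IsConnected Ω → SNPP.IsOmega goal γ₁ γ₂ Ω) ∧
      SNPP.Prec goal γ₁ γ₂ := by
  have hrel : SNPP.IsRelaxation goal γ₁ γ₂ Ω := hlt.isRelaxation hfree hstart hgoal
  have hsub : connectedComponentIn Ω (goal : ℂ) ⊆ Ω := connectedComponentIn_subset Ω _
  have hrelComponent : SNPP.IsRelaxation goal γ₁ γ₂ (connectedComponentIn Ω goal) :=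
    hlt.isRelaxation (hsub.trans hfree) (fun h => hstart (hsub h))
      (mem_connectedComponentIn hgoal)
  exact ⟨hrel, ⟨hrelComponent, isConnected_connectedComponentIn_iff.2 hgoal⟩,
    fun hconn => ⟨hrel, hconn⟩, hlt.of_endpoint hreach⟩

theorem mainTheorem2 {W : SNPP.World} (start goal : W.Conf)
    (hreach : SNPP.Reachable start goal) (T : SNPP.TopologicalTree start)
    {pᵢ pⱼ : W.Conf} {Nᵢ : SNPP.Node W pᵢ} {Nⱼ : SNPP.Node W pⱼ}
    (i : SNPP.Branch start pᵢ Nᵢ) (hi : T.mem i) (k : Fin Nᵢ.numGaps)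
    (j : SNPP.Branch start pⱼ Nⱼ) (hj : T.mem j) (l : Fin Nⱼ.numGaps)
    (hgoal : (goal : ℂ) ∉ i.covered)
    (hlt : ∀ m ∈ (Nᵢ.gap k).sweeper,
      SNPP.minLength (j.critPath l) m < SNPP.minLength (i.critPath k) m) :
    SNPP.IsRelaxation goal (j.critPath l) (i.critPath k) i.uncovered ∧
      SNPP.IsOmega goal (j.critPath l) (i.critPath k) (connectedComponentIn i.uncovered goal) ∧
      (IsConnected i.uncovered →
        SNPP.IsOmega goal (j.critPath l) (i.critPath k) i.uncovered) ∧
      SNPP.Prec goal (j.critPath l) (i.critPath k) :=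
  mainTheorem2_general hreach (hlt _ (Nᵢ.gap k).crit_mem_sweeper) Set.sdiff_subset
    (fun h => h.2 i.start_mem_covered) ⟨goal.2, hgoal⟩
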